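/- Let $K$ be a finite set of individual constants and $P$ a finite set of monadic predicate constants. **Trees.** A tree domain is a non-empty set $T\subseteq\mathbb N^*$ such that $uv\in T$ implies $u\in T$, and $ui\in T$, $j<i$ imply $uj\in T$ (for $u,v\in\mathbb N^*$, $i,j\in\mathbb N$). A tree over $(K,P)$ is a (finite or infinite) tree domain $T$ together with a node $I(k)\in T$ for each $k\in K$ and a set of nodes $R_p\subseteq T$ for each $p\in P$. The label of a node $u$ is the pair $(\{p\in P: u\in R_p\},\{k\in K: I(k)=u\})$. In this way a tree over $(K,P)$ is regarded as a tree domain with a labelling of its nodes. **Definability.** $L^2_{K,P}$ is the monadic second-order language with individual variables ranging over nodes, set variables ranging over arbitrary sets of nodes, the constants in $K$ and $P$, equality, and the binary predicates parent ($u$ is the parent of $ui$), domination ($u$ dominates $uv$), proper domination (domination and inequality) and left-of ($uiv$ is left of $ujw$ if $i<j$). A set $S$ of trees over $(K,P)$ is definable in $L^2_{K,P}$ if there is a finite set $\Phi$ of sentences of $L^2_{K,P}$ such that $S$ is the set of all trees over $(K,P)$ that satisfy every sentence in $\Phi$. **Derivation trees and projections.** A context-free grammar has finite alphabets of terminals and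 nonterminals, a start symbol, which is a nonterminal, and a finite set of productions $A\to\alpha$ (the right-hand side $\alpha$ may be empty). A derivation tree of it is a finite tree domain whose nodes are labelled with symbols such that the root is labelled with the start symbol, every node labelled with a terminal has no children, and the labels of the children of every node labelled with a nonterminal $A$, read from left to right, form the right-hand side of a production for $A$ (a node expanded by $A\to\varepsilon$ has no children). A set of trees over $(K,P)$ is the projection of a set $L$ of derivation trees along a map $\pi$ from the symbols to the labels if, as a set of labelled tree domains, it is the image of $L$ under relabelling each node by $\pi$. **Theorem.** Let $S$ be a set of finite trees over $(K,P)$ with bounded branching, that is, there is an $n$ such that no node of any tree in $S$ has more than $n$ children. 1. $S$ is definable in $L^2_{K,P}$ if and only if $S$ is the projection of a local set, i.e. of the set of all derivation trees of a finite set of context-free grammars (over common alphabets). 2. $S$ is definable in $L^2_{K,P}$ and all trees in $S$ have the same root label if and only if $S$ is the projection of the set of all derivation trees of a single context-free grammar. -/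

import Mathlib

namespace LKP

/-! ### The language: monadic second-order formulas over `K` and `P`

Individual variables and set variables are two countably infinite families, each indexed by `ℕ`. -/

/-- Individual terms: individual variables and individual constants. -/
inductive Term (K : Type*) where
  | var (x : ℕ) : Term K
  | const (k : K) : Term K

/-- Formulas. The binary predicates are parent, (reflexive) domination, proper domination, left-of
and equality. -/
inductive Formula (K P : Type*) where
  | parent (s t : Term K) : Formula K P
  | dominates (s t : Term K) : Formula K P
  | properlyDominates (s t : Term K) : Formula K P
  | leftOf (s t : Term K) : Formula K P
  | equal (s t : Term K) : Formula K P
  | pred (p : P) (t : Term K) : Formula K P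
  | mem (X : ℕ) (t : Term K) : Formula K P
  | not (φ : Formula K P) : Formula K P
  | and (φ ψ : Formula K P) : Formula K P
  | or (φ ψ : Formula K P) : Formula K P
  | imp (φ ψ : Formula K P) : Formula K P
  | iff (φ ψ : Formula K P) : Formula K P
  | all (x : ℕ) (φ : Formula K P) : Formula K P
  | ex (x : ℕ) (φ : Formula K P) : Formula K P
  | allSet (X : ℕ) (φ : Formula K P) : Formula K P
  | exSet (X : ℕ) (φ : Formula K P) : Formula K P

/-- The individual variables of a term. -/
def Term.vars {K : Type*} : Term K → Set ℕ
  | .var x => {x}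
  | .const _ => ∅

/-- The free individual variables of a formula. -/
def Formula.freeVars {K P : Type*} : Formula K P → Set ℕ
  | .parent s t => s.vars ∪ t.vars
  | .dominates s t => s.vars ∪ t.vars
  | .properlyDominates s t => s.vars ∪ t.vars
  | .leftOf s t => s.vars ∪ t.vars
  | .equal s t => s.vars ∪ t.vars
  | .pred _ t => t.vars
  | .mem _ t => t.vars
  | .not φ => φ.freeVars
  | .and φ ψ => φ.freeVars ∪ ψ.freeVars
  | .or φ ψ => φ.freeVars ∪ ψ.freeVars
  | .imp φ ψ => φ.freeVars ∪ ψ.freeVars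
  | .iff φ ψ => φ.freeVars ∪ ψ.freeVars
  | .all x φ => φ.freeVars \ {x}
  | .ex x φ => φ.freeVars \ {x}
  | .allSet _ φ => φ.freeVars
  | .exSet _ φ => φ.freeVars

/-- The free set variables of a formula. -/
def Formula.freeSetVars {K P : Type*} : Formula K P → Set ℕ
  | .parent _ _ => ∅
  | .dominates _ _ => ∅
  | .properlyDominates _ _ => ∅
  | .leftOf _ _ => ∅
  | .equal _ _ => ∅
  | .pred _ _ => ∅
  | .mem X _ => {X}
  | .not φ => φ.freeSetVars
  | .and φ ψ => φ.freeSetVars ∪ ψ.freeSetVars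
  | .or φ ψ => φ.freeSetVars ∪ ψ.freeSetVars
  | .imp φ ψ => φ.freeSetVars ∪ ψ.freeSetVars
  | .iff φ ψ => φ.freeSetVars ∪ ψ.freeSetVars
  | .all _ φ => φ.freeSetVars
  | .ex _ φ => φ.freeSetVars
  | .allSet X φ => φ.freeSetVars \ {X}
  | .exSet X φ => φ.freeSetVars \ {X}

/-- A sentence is a formula without free variables of either sort. -/
def Formula.IsSentence {K P : Type*} (φ : Formula K P) : Prop :=
  φ.freeVars = ∅ ∧ φ.freeSetVars = ∅

/-! ### Models and satisfaction -/

/-- A model `⟨U, I, 𝒫, 𝒟, ℒ, R_p⟩`, with a non-empty universe `U`. -/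
structure Model (K P : Type*) where
  U : Type
  nonempty : Nonempty U
  I : K → U
  parent : U → U → Prop
  dominates : U → U → Prop
  leftOf : U → U → Prop
  R : P → Set U

/-- The value of a term under an assignment of the individual variables. -/
def Term.val {K P : Type*} (M : Model K P) (s : ℕ → M.U) : Term K → M.U
  | .var x => s x
  | .const k => M.I k

/-- `φ.Sat M s S`: the model `M` satisfies `φ` with the assignment that sends the individual
variable `x` to `s x` and the set variable `X` to `S X`. -/
def Formula.Sat {K P : Type*} (M : Model K P) :
    Formula K P → (ℕ → M.U) → (ℕ → Set M.U) → Prop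
  | .parent a b, s, _ => M.parent (a.val M s) (b.val M s)
  | .dominates a b, s, _ => M.dominates (a.val M s) (b.val M s)
  | .properlyDominates a b, s, _ =>
      M.dominates (a.val M s) (b.val M s) ∧ a.val M s ≠ b.val M s
  | .leftOf a b, s, _ => M.leftOf (a.val M s) (b.val M s)
  | .equal a b, s, _ => a.val M s = b.val M s
  | .pred p a, s, _ => a.val M s ∈ M.R p
  | .mem X a, s, S => a.val M s ∈ S X
  | .not φ, s, S => ¬ φ.Sat M s S
  | .and φ ψ, s, S => φ.Sat M s S ∧ ψ.Sat M s S
  | .or φ ψ, s, S => φ.Sat M s S ∨ ψ.Sat M s S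
  | .imp φ ψ, s, S => φ.Sat M s S → ψ.Sat M s S
  | .iff φ ψ, s, S => (φ.Sat M s S ↔ ψ.Sat M s S)
  | .all x φ, s, S => ∀ a : M.U, φ.Sat M (Function.update s x a) S
  | .ex x φ, s, S => ∃ a : M.U, φ.Sat M (Function.update s x a) S
  | .allSet X φ, s, S => ∀ A : Set M.U, φ.Sat M s (Function.update S X A)
  | .exSet X φ, s, S => ∃ A : Set M.U, φ.Sat M s (Function.update S X A)

/-- `M ⊨ φ`: the model satisfies `φ` with any assignment. -/
def Model.Models {K P : Type*} (M : Model K P) (φ : Formula K P) : Prop :=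
  ∀ (s : ℕ → M.U) (S : ℕ → Set M.U), φ.Sat M s S

/-! ### Tree domains and trees -/

/-- A tree domain: a non-empty, prefix-closed set of addresses that contains with `u · i` every
`u · j`, `j < i`. It may be infinite, and a node may have infinitely many children. -/
structure TreeDomain where
  nodes : Set (List ℕ)
  nonempty : nodes.Nonempty
  td1 : ∀ u v : List ℕ, u ++ v ∈ nodes → u ∈ nodes
  td2 : ∀ (u : List ℕ) (i j : ℕ), u ++ [i] ∈ nodes → j < i → u ++ [j] ∈ nodes

theorem TreeDomain.nil_mem (T : TreeDomain) : [] ∈ T.nodes := by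
  obtain ⟨u, hu⟩ := T.nonempty
  exact T.td1 [] u hu

/-- The root, at the empty address. -/
def TreeDomain.root (T : TreeDomain) : T.nodes := ⟨[], T.nil_mem⟩

/-- A tree domain with interpretations of the constants: an individual constant names a node, a
predicate constant names a set of nodes. -/
structure Tree (K P : Type*) where
  dom : TreeDomain
  I : K → dom.nodes
  R : P → Set dom.nodes

/-- The intended models: the natural interpretation of the tree domain, together with the
interpretations of the constants. -/
def Tree.toModel {K P : Type*} (t : Tree K P) : Model K P where
  U := t.dom.nodes
  nonempty := ⟨t.dom.root⟩
  I := t.I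
  parent x y := ∃ i : ℕ, (y : List ℕ) = (x : List ℕ) ++ [i]
  dominates x y := ∃ v : List ℕ, (y : List ℕ) = (x : List ℕ) ++ v
  leftOf x y := ∃ (u v w : List ℕ) (i j : ℕ), i < j ∧
    (x : List ℕ) = u ++ [i] ++ v ∧ (y : List ℕ) = u ++ [j] ++ w
  R := t.R

/-- `Mod Φ`: the set of all trees, finite or infinite, that satisfy every member of `Φ`. -/
def Mod {K P : Type*} (Φ : Set (Formula K P)) : Set (Tree K P) :=
  {t | ∀ φ ∈ Φ, t.toModel.Models φ}

/-- A set of trees is definable if it is `Mod Φ` for a finite set `Φ` of sentences. -/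
def Definable {K P : Type*} (S : Set (Tree K P)) : Prop :=
  ∃ Φ : Set (Formula K P), Φ.Finite ∧ (∀ φ ∈ Φ, φ.IsSentence) ∧ S = Mod Φ

/-- Every tree of the set is finite. -/
def AllFinite {K P : Type*} (S : Set (Tree K P)) : Prop :=
  ∀ t ∈ S, t.dom.nodes.Finite

/-- One number bounds the number of children of every node of every tree of the set. -/
def BoundedBranching {K P : Type*} (S : Set (Tree K P)) : Prop :=
  ∃ n : ℕ, ∀ t ∈ S, ∀ (u : List ℕ) (i : ℕ), u ++ [i] ∈ t.dom.nodes → i < n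

/-! ### Labelled trees, derivation trees, projections -/

/-- A tree domain whose nodes carry labels from `A`. -/
structure LabeledTree (A : Type*) where
  dom : TreeDomain
  label : dom.nodes → A

/-- The projection of a labelled tree along a map of the alphabets: relabel each node. -/
def LabeledTree.map {A B : Type*} (π : A → B) (t : LabeledTree A) : LabeledTree B where
  dom := t.dom
  label u := π (t.label u)

/-- A tree as a labelled tree: a node is labelled with the set of the predicate constants that hold
of it and the set of the individual constants that name it. -/
def Tree.toLabeled {K P : Type*} (t : Tree K P) : LabeledTree (Set P × Set K) where
  dom := t.dom
  label u := ({p | u ∈ t.R p}, {k | t.I k = u})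

/-- `t` is a derivation tree of the context-free grammar `G`: it is finite, its root is labelled
with the start symbol, nodes labelled with terminals have no children, and a node labelled with a
nonterminal `A` has children labelled, from left to right, with the right-hand side of a production
for `A`. (So a node that is expanded by `A → ε` has no children.) -/
def IsDerivationTree {T : Type*} (G : ContextFreeGrammar T)
    (t : LabeledTree (Symbol T G.NT)) : Prop :=
  t.dom.nodes.Finite ∧
  t.label t.dom.root = Symbol.nonterminal G.initial ∧
  (∀ (u : t.dom.nodes) (a : T), t.label u = Symbol.terminal a →
    ∀ i : ℕ, (u : List ℕ) ++ [i] ∉ t.dom.nodes) ∧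
  (∀ (u : t.dom.nodes) (A : G.NT), t.label u = Symbol.nonterminal A →
    ∃ r ∈ G.rules, r.input = A ∧
      (∀ i : ℕ, (u : List ℕ) ++ [i] ∈ t.dom.nodes ↔ i < r.output.length) ∧
      (∀ (i : ℕ) (h : (u : List ℕ) ++ [i] ∈ t.dom.nodes),
        r.output[i]? = some (t.label ⟨(u : List ℕ) ++ [i], h⟩)))

/-- The set of derivation trees of the grammar with terminals `T`, nonterminals `N`, start symbol
`A` and productions `R`. -/
def derivationTrees {T N : Type} (A : N) (R : Finset (ContextFreeRule T N)) :
    Set (LabeledTree (Symbol T N)) :=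
  {t | IsDerivationTree (⟨N, A, R⟩ : ContextFreeGrammar T) t}

/-- `S` is the projection of the set of trees generated by a finite set of context-free grammars
(start symbol and productions) over common finite alphabets. -/
def IsProjectionOfLocal {K P : Type*} (S : Set (Tree K P)) : Prop :=
  ∃ (T N : Type) (_ : Finite T) (_ : Finite N) (𝒢 : Set (N × Finset (ContextFreeRule T N)))
    (π : Symbol T N → Set P × Set K), 𝒢.Finite ∧
    Tree.toLabeled '' S = LabeledTree.map π '' (⋃ g ∈ 𝒢, derivationTrees g.1 g.2)

/-- `S` is the projection of the set of derivation trees of a single context-free grammar. -/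
def IsProjectionOfCFG {K P : Type*} (S : Set (Tree K P)) : Prop :=
  ∃ (T N : Type) (_ : Finite T) (_ : Finite N) (A : N) (R : Finset (ContextFreeRule T N))
    (π : Symbol T N → Set P × Set K),
    Tree.toLabeled '' S = LabeledTree.map π '' derivationTrees A R

/-- All trees of the set have the same root label. -/
def SameRootLabel {K P : Type*} (S : Set (Tree K P)) : Prop :=
  ∀ t ∈ S, ∀ t' ∈ S,
    t.toLabeled.label t.toLabeled.dom.root = t'.toLabeled.label t'.toLabeled.dom.root

end LKP

/-! From logic to grammars, the argument is the automata-theoretic one. An assignment is coded by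
unary predicates on the nodes, individuals becoming singletons, and `Formula.recognized` shows that
a deterministic bottom-up automaton decides each formula on finite trees. Determinism makes
complement trivial, products give the Boolean connectives, and the subset construction
`BottomUp.exists_set` gives the set quantifiers. A transition function reads arbitrary finite lists
of child states with no regularity condition: since branching is bounded, only finitely many lists
matter once the automaton becomes a grammar. In `exists_grammar` the nonterminals guess a label and
a state, and the productions are the correct transitions, so a derivation tree is a run written into
the tree.

From grammars to logic, a formula guesses the symbols of a derivation tree by one set variable per
symbol, and checks productions locally by means of `Expressible.nthChild`, together with the
projection to labels. Finiteness, which is not a local condition, is replaced by an induction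
principle quantifying over sets of nodes; on a finitely branching tree it is equivalent to
finiteness (`TreeDomain.finite_of_induction`).

For a single grammar, the start symbol fixes the root label. Conversely, the constructed grammars
differ only in their start symbols, one for each root label, so a common root label leaves only one
of them. -/

namespace LKP

/-! ### Tree domains -/

namespace TreeDomain

/-- `l` lists, from left to right, the values of `f` at the children of `u`. -/
def ChildList {α : Type*} (T : TreeDomain) (u : T.nodes) (f : T.nodes → α) (l : List α) : Prop :=
  (∀ i : ℕ, (u : List ℕ) ++ [i] ∈ T.nodes ↔ i < l.length) ∧
    ∀ (i : ℕ) (h : (u : List ℕ) ++ [i] ∈ T.nodes), l[i]? = some (f ⟨(u : List ℕ) ++ [i], h⟩)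

variable {α β : Type*} {T : TreeDomain} {u : T.nodes} {f g : T.nodes → α} {l : List α}

theorem ChildList.map (h : T.ChildList u f l) (k : α → β) :
    T.ChildList u (fun v => k (f v)) (l.map k) := by
  refine ⟨fun i => by simpa using h.1 i, fun i hi => by simp [h.2 i hi]⟩

theorem ChildList.congr (h : T.ChildList u f l)
    (hfg : ∀ (i : ℕ) (hi : (u : List ℕ) ++ [i] ∈ T.nodes), f ⟨_, hi⟩ = g ⟨_, hi⟩) :
    T.ChildList u g l :=
  ⟨h.1, fun i hi => by rw [h.2 i hi, hfg i hi]⟩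

theorem ChildList.mem_iff (h : T.ChildList u f l) {a : α} :
    a ∈ l ↔ ∃ (i : ℕ) (hi : (u : List ℕ) ++ [i] ∈ T.nodes), f ⟨_, hi⟩ = a := by
  rw [List.mem_iff_getElem?]
  constructor
  · rintro ⟨i, hi⟩
    have hm : (u : List ℕ) ++ [i] ∈ T.nodes := (h.1 i).2 (List.getElem?_eq_some_iff.1 hi).1
    exact ⟨i, hm, by simpa [h.2 i hm] using hi⟩
  · rintro ⟨i, hi, rfl⟩
    exact ⟨i, h.2 i hi⟩

/-- By `td2` the child indices form an initial segment of `ℕ`, so the least missing index is the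
number of children. -/
theorem exists_childList_of_bound (u : T.nodes) (f : T.nodes → α)
    (hb : ∃ m : ℕ, (u : List ℕ) ++ [m] ∉ T.nodes) : ∃ l, T.ChildList u f l := by
  classical
  have key : ∀ i, (u : List ℕ) ++ [i] ∈ T.nodes ↔ i < Nat.find hb := by
    intro i
    constructor
    · intro hi
      by_contra hlt
      rcases (not_lt.1 hlt).eq_or_lt with h | h
      · exact Nat.find_spec hb (h ▸ hi)
      · exact Nat.find_spec hb (T.td2 _ _ _ hi h)
    · intro hi
      by_contra hn
      exact Nat.find_min hb hi hn
  refine ⟨List.ofFn fun i : Fin (Nat.find hb) => f ⟨(u : List ℕ) ++ [(i : ℕ)], (key i).2 i.2⟩,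
    by simpa using key, fun i hi => ?_⟩
  have := (key i).1 hi
  simp [this]

theorem exists_childList (hT : T.nodes.Finite) (u : T.nodes) (f : T.nodes → α) :
    ∃ l, T.ChildList u f l := by
  apply exists_childList_of_bound
  by_contra! hall
  refine Set.infinite_of_injective_forall_mem (f := fun m : ℕ => (u : List ℕ) ++ [m]) ?_ hall hT
  intro a b hab
  simpa using hab

theorem induction_of_finite (hT : T.nodes.Finite) (p : T.nodes → Prop)
    (step : ∀ u : T.nodes, (∀ (i : ℕ) (h : (u : List ℕ) ++ [i] ∈ T.nodes), p ⟨_, h⟩) → p u)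
    (u : T.nodes) : p u := by
  obtain ⟨N, hN⟩ := (hT.image List.length).bddAbove
  -- `N` bounds the depth of the nodes; `k` bounds the remaining height above which the induction
  -- climbs.
  have key : ∀ (k : ℕ) (u : T.nodes), N < (u : List ℕ).length + k → p u := by
    intro k
    induction k with
    | zero =>
      intro u hu
      have : (u : List ℕ).length ≤ N := hN ⟨u, u.2, rfl⟩
      omega
    | succ k ih =>
      intro u hu
      refine step u fun i h => ih _ ?_
      simp only [List.length_append, List.length_singleton]
      omega
  exact key (N + 1) u (by omega)

theorem prefix_iff {u v : List ℕ} (hv : v ∈ T.nodes) :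
    u <+: v ↔ v = u ∨ ∃ i : ℕ, u ++ [i] ∈ T.nodes ∧ (u ++ [i]) <+: v := by
  constructor
  · rintro ⟨w, rfl⟩
    cases w with
    | nil => simp
    | cons i w =>
      refine Or.inr ⟨i, T.td1 _ w (by simpa using hv), ⟨w, by simp⟩⟩
  · rintro (rfl | ⟨i, -, w, rfl⟩)
    · exact List.prefix_rfl
    · exact ⟨i :: w, by simp⟩

/-- A form of König's lemma: apply the induction principle to the set of nodes with a finite
subtree. A bound that varies with the node suffices. -/
theorem finite_of_induction (hb : ∀ u : T.nodes, ∃ m : ℕ, ∀ i : ℕ, (u : List ℕ) ++ [i] ∈ T.nodes → i < m)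
    (ind : ∀ p : Set T.nodes,
      (∀ u : T.nodes, (∀ (i : ℕ) (h : (u : List ℕ) ++ [i] ∈ T.nodes), ⟨_, h⟩ ∈ p) → u ∈ p) →
        ∀ u : T.nodes, u ∈ p) : T.nodes.Finite := by
  have := ind {u | {v | v ∈ T.nodes ∧ (u : List ℕ) <+: v}.Finite} ?_ T.root
  · refine this.subset fun v hv => ⟨hv, ?_⟩
    exact List.nil_prefix
  · intro u hu
    obtain ⟨m, hm⟩ := hb u
    have hfin : (⋃ i ∈ Set.Iio m,
        {v | v ∈ T.nodes ∧ (u : List ℕ) ++ [i] ∈ T.nodes ∧ ((u : List ℕ) ++ [i]) <+: v}).Finite := by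
      refine (Set.finite_Iio m).biUnion fun i _ => ?_
      by_cases hi : (u : List ℕ) ++ [i] ∈ T.nodes
      · exact (hu i hi).subset fun v hv => ⟨hv.1, hv.2.2⟩
      · simp [hi]
    refine (hfin.insert (u : List ℕ)).subset ?_
    rintro v ⟨hv, huv⟩
    rcases (prefix_iff hv).1 huv with rfl | ⟨i, hi, hiv⟩
    · exact Set.mem_insert _ _
    · refine Set.mem_insert_of_mem _ ?_
      simp only [Set.mem_iUnion]
      exact ⟨i, hm i hi, hv, hi, hiv⟩

end TreeDomain

/-! ### Bottom-up automata -/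

section BottomUp

variable {ι Q γ γ' : Type*}

/-- `ρ` is a run of the bottom-up automaton with transition function `δ` on the tree domain `T`
whose nodes carry the indices of the sets `V` they belong to. -/
def IsRun {T : TreeDomain} (δ : Set ι → List Q → Q) (V : ι → Set T.nodes) (ρ : T.nodes → Q) :
    Prop :=
  ∀ (u : T.nodes) (l : List Q), T.ChildList u ρ l → ρ u = δ {i | u ∈ V i} l

/-- The automaton is deterministic and works upwards, so a state depends only on the subtree below.
This locality permits the gluing in `BottomUp.exists_set`. -/
theorem IsRun.eq_of_agree {T : TreeDomain} (hT : T.nodes.Finite) {δ : Set ι → List Q → Q}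
    {V V' : ι → Set T.nodes} {ρ ρ' : T.nodes → Q} (h : IsRun δ V ρ) (h' : IsRun δ V' ρ')
    (u : T.nodes)
    (hag : ∀ v : T.nodes, (u : List ℕ) <+: v → ∀ i, v ∈ V i ↔ v ∈ V' i) : ρ u = ρ' u := by
  induction u using TreeDomain.induction_of_finite hT with
  | step u ih =>
    obtain ⟨l, hl⟩ := T.exists_childList hT u ρ
    have hl' : T.ChildList u ρ' l := hl.congr fun i hi =>
      ih i hi fun v hv => hag v ((List.prefix_append _ _).trans hv)
    rw [h u l hl, h' u l hl']
    congr 1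
    ext i
    exact hag u List.prefix_rfl i

/-- A function on the nodes of finite trees is computed by a finite bottom-up automaton. -/
def BottomUp (f : ∀ T : TreeDomain, (ι → Set T.nodes) → T.nodes → γ) : Prop :=
  ∃ (Q : Type) (_ : Finite Q) (δ : Set ι → List Q → Q) (o : Q → γ),
    ∀ T : TreeDomain, T.nodes.Finite → ∀ V : ι → Set T.nodes,
      ∃ ρ : T.nodes → Q, IsRun δ V ρ ∧ ∀ u, f T V u = o (ρ u)

variable {f : ∀ T : TreeDomain, (ι → Set T.nodes) → T.nodes → γ}
  {g : ∀ T : TreeDomain, (ι → Set T.nodes) → T.nodes → γ'}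

theorem BottomUp.comp (hf : BottomUp f) (k : γ → γ') : BottomUp fun T V u => k (f T V u) := by
  obtain ⟨Q, _, δ, o, H⟩ := hf
  refine ⟨Q, ‹_›, δ, k ∘ o, fun T hT V => ?_⟩
  obtain ⟨ρ, hρ, ho⟩ := H T hT V
  exact ⟨ρ, hρ, fun u => by simp [ho]⟩

theorem BottomUp.pair (hf : BottomUp f) (hg : BottomUp g) :
    BottomUp fun T V u => (f T V u, g T V u) := by
  obtain ⟨Q, _, δ, o, H⟩ := hf
  obtain ⟨Q', _, δ', o', H'⟩ := hg
  refine ⟨Q × Q', inferInstance, fun a l => (δ a (l.map Prod.fst), δ' a (l.map Prod.snd)),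
    Prod.map o o', fun T hT V => ?_⟩
  obtain ⟨ρ, hρ, ho⟩ := H T hT V
  obtain ⟨ρ', hρ', ho'⟩ := H' T hT V
  refine ⟨fun u => (ρ u, ρ' u), fun u l hl => ?_, fun u => by simp [ho, ho']⟩
  exact Prod.ext (hρ u _ (hl.map Prod.fst)) (hρ' u _ (hl.map Prod.snd))

theorem bottomUp_mem (i : ι) : BottomUp fun T (V : ι → Set T.nodes) u => u ∈ V i :=
  ⟨Prop, inferInstance, fun a _ => i ∈ a, id, fun _ _ V =>
    ⟨fun u => u ∈ V i, fun _ _ _ => rfl, fun _ => rfl⟩⟩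

theorem bottomUp_const (c : γ) : BottomUp fun T (_ : ι → Set T.nodes) _ => c :=
  ⟨Unit, inferInstance, fun _ _ => (), fun _ => c, fun _ _ _ =>
    ⟨fun _ => (), fun _ _ _ => rfl, fun _ => rfl⟩⟩

/-- The state is enlarged by the current value of `g`. That value is stored in `Fin m` because `γ'`
may live in another universe than the state sets. -/
theorem BottomUp.children [Finite γ'] (hf : BottomUp f) (k : List γ → γ')
    (h : ∀ T : TreeDomain, ∀ (V : ι → Set T.nodes) (u : T.nodes) (l : List γ),
      T.ChildList u (f T V) l → g T V u = k l) : BottomUp g := by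
  obtain ⟨Q, _, δ, o, H⟩ := hf
  obtain ⟨m, ⟨e⟩⟩ := Finite.exists_equiv_fin γ'
  refine ⟨Q × Fin m, inferInstance,
    fun a l => (δ a (l.map Prod.fst), e (k (l.map fun q => o q.1))), fun q => e.symm q.2,
    fun T hT V => ?_⟩
  obtain ⟨ρ, hρ, ho⟩ := H T hT V
  refine ⟨fun u => (ρ u, e (g T V u)), fun u l hl => ?_, fun u => by simp⟩
  refine Prod.ext (hρ u _ (hl.map Prod.fst)) ?_
  simp only [EmbeddingLike.apply_eq_iff_eq]
  apply h
  have := hl.map fun q => o q.1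
  simpa only [← ho] using this

theorem BottomUp.not {p : ∀ T : TreeDomain, (ι → Set T.nodes) → T.nodes → Prop}
    (hp : BottomUp p) : BottomUp fun T V u => ¬ p T V u :=
  hp.comp Not

section Predicates

variable {p q : ∀ T : TreeDomain, (ι → Set T.nodes) → T.nodes → Prop}

theorem BottomUp.and (hp : BottomUp p) (hq : BottomUp q) :
    BottomUp fun T V u => p T V u ∧ q T V u :=
  (hp.pair hq).comp fun x => x.1 ∧ x.2

theorem BottomUp.or (hp : BottomUp p) (hq : BottomUp q) :
    BottomUp fun T V u => p T V u ∨ q T V u :=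
  (hp.pair hq).comp fun x => x.1 ∨ x.2

theorem BottomUp.forall_finite {κ : Type*} [Finite κ]
    {p : κ → ∀ T : TreeDomain, (ι → Set T.nodes) → T.nodes → Prop}
    (hp : ∀ k, BottomUp (p k)) : BottomUp fun T V u => ∀ k, p k T V u := by
  classical
  have := Fintype.ofFinite κ
  have key : ∀ s : Finset κ, BottomUp fun T V u => ∀ k ∈ s, p k T V u := by
    intro s
    induction s using Finset.induction_on with
    | empty => simpa using bottomUp_const True
    | insert a s _ ih => simpa only [Finset.forall_mem_insert] using (hp a).and ih
  simpa using key Finset.univ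

theorem BottomUp.exists_child (hp : BottomUp p) :
    BottomUp fun T V u => ∃ (i : ℕ) (h : (u : List ℕ) ++ [i] ∈ T.nodes), p T V ⟨_, h⟩ := by
  refine hp.children (fun l => True ∈ l) fun T V u l hl => ?_
  simp [hl.mem_iff]

theorem BottomUp.exists_child_lt_child (hp : BottomUp p) (hq : BottomUp q) :
    BottomUp fun T V u => ∃ (i j : ℕ) (hi : (u : List ℕ) ++ [i] ∈ T.nodes)
      (hj : (u : List ℕ) ++ [j] ∈ T.nodes), i < j ∧ p T V ⟨_, hi⟩ ∧ q T V ⟨_, hj⟩ := by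
  refine (hp.pair hq).children (fun l => ∃ (i j : ℕ) (x y : Prop × Prop), i < j ∧
    l[i]? = some x ∧ l[j]? = some y ∧ x.1 ∧ y.2) fun T V u l hl => ?_
  refine propext ⟨?_, ?_⟩
  · rintro ⟨i, j, hi, hj, hij, h1, h2⟩
    exact ⟨i, j, _, _, hij, hl.2 i hi, hl.2 j hj, h1, h2⟩
  · rintro ⟨i, j, x, y, hij, hx, hy, h1, h2⟩
    have hi := (hl.1 i).2 (List.getElem?_eq_some_iff.1 hx).1
    have hj := (hl.1 j).2 (List.getElem?_eq_some_iff.1 hy).1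
    rw [hl.2 i hi, Option.some.injEq] at hx
    rw [hl.2 j hj, Option.some.injEq] at hy
    subst hx hy
    exact ⟨i, j, hi, hj, hij, h1, h2⟩

/-- This is recursive, unlike `BottomUp.children`: an extra bit records whether a witness has been
met, and is set by the node itself or inherited from a child. -/
theorem BottomUp.below (hp : BottomUp p) :
    BottomUp fun T V u => ∃ v : T.nodes, (u : List ℕ) <+: v ∧ p T V v := by
  obtain ⟨Q, _, δ, o, H⟩ := hp
  refine ⟨Q × Prop, inferInstance,
    fun a l => (δ a (l.map Prod.fst), o (δ a (l.map Prod.fst)) ∨ True ∈ l.map Prod.snd), Prod.snd,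
    fun T hT V => ?_⟩
  obtain ⟨ρ, hρ, ho⟩ := H T hT V
  refine ⟨fun u => (ρ u, ∃ v : T.nodes, (u : List ℕ) <+: v ∧ p T V v), fun u l hl => ?_,
    fun u => rfl⟩
  refine Prod.ext (hρ u _ (hl.map Prod.fst)) (propext ?_)
  dsimp only
  rw [← hρ u _ (hl.map Prod.fst), ← ho, (hl.map Prod.snd).mem_iff]
  constructor
  · rintro ⟨v, huv, hv⟩
    rcases (TreeDomain.prefix_iff v.2).1 huv with h | ⟨i, hi, hiv⟩
    · rw [Subtype.ext h] at hv
      exact Or.inl hv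
    · exact Or.inr ⟨i, hi, eq_true ⟨v, hiv, hv⟩⟩
  · rintro (h | ⟨i, hi, h⟩)
    · exact ⟨u, List.prefix_rfl, h⟩
    · obtain ⟨v, hv, hpv⟩ := of_eq_true h
      exact ⟨v, (List.prefix_append _ _).trans hv, hpv⟩

-- Subset construction: the new state at a node is the set of states reached there for all choices
-- of `B`. Choices made separately for the children and for the node combine into one, because the
-- subtrees of distinct children are disjoint.
open Classical in
theorem BottomUp.exists_set (hp : BottomUp p) (x : ι) :
    BottomUp fun T V u => ∃ B : Set T.nodes, p T (Function.update V x B) u := by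
  obtain ⟨Q, _, δ, o, H⟩ := hp
  -- `b` guesses whether the node lies in the quantified set, and `l` picks one reachable state for
  -- each child.
  refine ⟨Set Q, inferInstance, fun a ls => {q | ∃ (b : Prop) (l : List Q),
    l.length = ls.length ∧ (∀ (i : ℕ) (q : Q) (s : Set Q), l[i]? = some q → ls[i]? = some s → q ∈ s) ∧
      q = δ {i | if i = x then b else i ∈ a} l}, fun s => ∃ q ∈ s, o q, fun T hT V => ?_⟩
  choose ρ hρ ho using fun B => H T hT (Function.update V x B)
  have hlab : ∀ B (u : T.nodes), {i | u ∈ Function.update V x B i} =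
      {i | if i = x then u ∈ B else i ∈ {i | u ∈ V i}} := by
    intro B u
    ext i
    by_cases h : i = x
    · subst h; simp
    · simp [h]
  refine ⟨fun u => Set.range fun B => ρ B u, fun u ls hls => ?_, fun u => by simp [ho]⟩
  ext q
  constructor
  · rintro ⟨B, rfl⟩
    obtain ⟨l, hl⟩ := T.exists_childList hT u (ρ B)
    refine ⟨u ∈ B, l, ?_, ?_, by rw [← hlab]; exact hρ B u l hl⟩
    · exact eq_of_forall_lt_iff fun i => by rw [← hl.1, ← hls.1]
    · intro i q s hq hs
      have hi := (hl.1 i).2 (List.getElem?_eq_some_iff.1 hq).1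
      rw [hl.2 i hi, Option.some.injEq] at hq
      rw [hls.2 i hi, Option.some.injEq] at hs
      subst hq hs
      exact ⟨B, rfl⟩
  · rintro ⟨b, l, hlen, hmem, rfl⟩
    have hB : ∀ (i : ℕ) (hi : (u : List ℕ) ++ [i] ∈ T.nodes),
        ∃ B, l[i]? = some (ρ B ⟨_, hi⟩) := by
      intro i hi
      have hlt : i < l.length := hlen ▸ (hls.1 i).1 hi
      obtain ⟨B, hB⟩ := hmem i l[i] _ (List.getElem?_eq_getElem hlt) (hls.2 i hi)
      exact ⟨B, by rw [List.getElem?_eq_getElem hlt, ← hB]⟩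
    choose B hB using hB
    -- The glued set: `b` decides at `u`, and `B i hi` decides in the subtree of the `i`-th child.
    -- Nodes outside the subtree of `u` are irrelevant and left out.
    let B' : Set T.nodes := {v | (v = u ∧ b) ∨ ∃ (i : ℕ) (hi : (u : List ℕ) ++ [i] ∈ T.nodes),
      ((u : List ℕ) ++ [i]) <+: v ∧ v ∈ B i hi}
    have hu : u ∈ B' ↔ b := by
      constructor
      · rintro (⟨-, h⟩ | ⟨i, hi, h, -⟩)
        · exact h
        · simpa using h.length_le
      · exact fun h => Or.inl ⟨rfl, h⟩
    have hB' : ∀ (i : ℕ) (hi : (u : List ℕ) ++ [i] ∈ T.nodes),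
        ρ (B i hi) ⟨_, hi⟩ = ρ B' ⟨_, hi⟩ := by
      intro i hi
      refine (hρ (B i hi)).eq_of_agree hT (hρ B') _ fun v hv j => ?_
      by_cases hj : j = x
      · subst hj
        simp only [Function.update_self]
        constructor
        · exact fun h => Or.inr ⟨i, hi, hv, h⟩
        · rintro (⟨rfl, -⟩ | ⟨i', hi', hv', h⟩)
          · simpa using hv.length_le
          · obtain ⟨w, hw⟩ := hv
            obtain ⟨w', hw'⟩ := hv'
            have : i' = i := by
              have := hw'.trans hw.symm
              simp only [List.append_assoc, List.append_cancel_left_eq] at this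
              simpa using (List.cons.inj this).1
            subst this
            exact h
      · simp [hj]
    refine ⟨B', ?_⟩
    have := hρ B' u l ⟨fun i => by rw [hls.1, hlen], fun i hi => by rw [hB i hi, hB' i hi]⟩
    simpa only [hlab, hu] using this

end Predicates

end BottomUp

/-! ### Recognizability of the relations definable by formulas -/

theorem list_trichotomy (x y : List ℕ) (h : x ≠ y) :
    (∃ i w, y = x ++ [i] ++ w) ∨ (∃ i w, x = y ++ [i] ++ w) ∨
      ∃ u i j v w, (i < j ∨ j < i) ∧ x = u ++ [i] ++ v ∧ y = u ++ [j] ++ w := by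
  induction x generalizing y with
  | nil =>
    cases y with
    | nil => exact absurd rfl h
    | cons b y => exact Or.inl ⟨b, y, by simp⟩
  | cons a x ih =>
    cases y with
    | nil => exact Or.inr (Or.inl ⟨a, x, by simp⟩)
    | cons b y =>
      by_cases hab : a = b
      · subst hab
        rcases ih y (fun e => h (by rw [e])) with ⟨i, w, rfl⟩ | ⟨i, w, rfl⟩ |
          ⟨u, i, j, v, w, hij, rfl, rfl⟩
        · exact Or.inl ⟨i, w, by simp⟩
        · exact Or.inr (Or.inl ⟨i, w, by simp⟩)
        · exact Or.inr (Or.inr ⟨a :: u, i, j, v, w, hij, by simp, by simp⟩)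
      · exact Or.inr (Or.inr ⟨[], a, b, x, y, lt_or_gt_of_ne hab, by simp, by simp⟩)

/-- By `list_trichotomy`, two distinct members either lie one properly below the other, or lie below
two different children of one node. Both patterns can be detected bottom-up, so the automaton checks
for a member and excludes both patterns. -/
theorem exists_bottomUp_singleton {ι : Type*} (i : ι) :
    ∃ f : ∀ T : TreeDomain, (ι → Set T.nodes) → T.nodes → Prop, BottomUp f ∧
      ∀ (T : TreeDomain) (V : ι → Set T.nodes), f T V T.root ↔ ∃ a, V i = {a} := by
  have hb := (bottomUp_mem i).below
  refine ⟨_, hb.and (((bottomUp_mem i).and hb.exists_child).or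
    (hb.exists_child_lt_child hb)).below.not, fun T V => ?_⟩
  constructor
  · rintro ⟨⟨a, -, ha⟩, hn⟩
    refine ⟨a, Set.eq_singleton_iff_unique_mem.2 ⟨ha, fun b hb => ?_⟩⟩
    by_contra hne
    apply hn
    have hne' : (b : List ℕ) ≠ a := fun e => hne (Subtype.ext e)
    rcases list_trichotomy _ _ hne' with ⟨j, w, h⟩ | ⟨j, w, h⟩ | ⟨u, j, k, v, w, hjk, h, h'⟩
    · exact ⟨b, List.nil_prefix, Or.inl ⟨hb, j, T.td1 _ w (h ▸ a.2), a, ⟨w, h.symm⟩, ha⟩⟩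
    · exact ⟨a, List.nil_prefix, Or.inl ⟨ha, j, T.td1 _ w (h ▸ b.2), b, ⟨w, h.symm⟩, hb⟩⟩
    · have hj : u ++ [j] ∈ T.nodes := T.td1 _ v (h ▸ b.2)
      have hk : u ++ [k] ∈ T.nodes := T.td1 _ w (h' ▸ a.2)
      refine ⟨⟨u, T.td1 _ _ hj⟩, List.nil_prefix, Or.inr ?_⟩
      rcases hjk with hjk | hjk
      · exact ⟨j, k, hj, hk, hjk, ⟨b, ⟨v, h.symm⟩, hb⟩, a, ⟨w, h'.symm⟩, ha⟩
      · exact ⟨k, j, hk, hj, hjk, ⟨a, ⟨w, h'.symm⟩, ha⟩, b, ⟨v, h.symm⟩, hb⟩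
  · rintro ⟨a, ha⟩
    simp only [ha, Set.mem_singleton_iff]
    refine ⟨⟨a, List.nil_prefix, rfl⟩, ?_⟩
    rintro ⟨v, -, ⟨rfl, j, hj, w, hw, rfl⟩ | ⟨j, k, hj, hk, hjk, ⟨b, hb, rfl⟩, c, hc, rfl⟩⟩
    · simpa using hw.length_le
    · obtain ⟨w, hw⟩ := hb
      obtain ⟨w', hw'⟩ := hc
      have := hw.trans hw'.symm
      simp only [List.append_assoc, List.append_cancel_left_eq] at this
      exact hjk.ne (by simpa using (List.cons.inj this).1)

/-- The indices of the unary predicates that formulas speak about. -/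
inductive Idx (K P : Type*) where
  | pred (p : P) : Idx K P
  | const (k : K) : Idx K P
  | var (x : ℕ) : Idx K P
  | setVar (X : ℕ) : Idx K P

variable {K P : Type*}

/-- The unary predicates of a tree with an assignment; individuals become singletons. -/
def Tree.valuation (t : Tree K P) (s : ℕ → t.dom.nodes) (S : ℕ → Set t.dom.nodes) :
    Idx K P → Set t.dom.nodes
  | .pred p => t.R p
  | .const k => {t.I k}
  | .var x => {s x}
  | .setVar X => S X

/-- The index of a term. -/
def Term.idx : Term K → Idx K P
  | .var x => .var x
  | .const k => .const k

theorem Tree.valuation_idx (t : Tree K P) (s : ℕ → t.dom.nodes) (S : ℕ → Set t.dom.nodes)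
    (a : Term K) : t.valuation s S a.idx = {a.val t.toModel s} := by
  cases a <;> rfl

open Classical in
theorem Tree.valuation_update_var (t : Tree K P) (s : ℕ → t.dom.nodes)
    (S : ℕ → Set t.dom.nodes) (x : ℕ) (a : t.dom.nodes) :
    t.valuation (Function.update s x a) S = Function.update (t.valuation s S) (.var x) {a} := by
  funext i
  cases i with
  | var y => by_cases h : y = x <;> simp [Tree.valuation, h]
  | _ => simp [Tree.valuation]

open Classical in
theorem Tree.valuation_update_setVar (t : Tree K P) (s : ℕ → t.dom.nodes)
    (S : ℕ → Set t.dom.nodes) (X : ℕ) (A : Set t.dom.nodes) :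
    t.valuation s (Function.update S X A) = Function.update (t.valuation s S) (.setVar X) A := by
  funext i
  cases i with
  | setVar Y => by_cases h : Y = X <;> simp [Tree.valuation, h]
  | _ => simp [Tree.valuation]

/-- A property of finite trees with assignments that is decided by a bottom-up automaton. -/
def Recognized (p : ∀ t : Tree K P, (ℕ → t.dom.nodes) → (ℕ → Set t.dom.nodes) → Prop) : Prop :=
  ∃ f : ∀ T : TreeDomain, (Idx K P → Set T.nodes) → T.nodes → Prop, BottomUp f ∧
    ∀ (t : Tree K P), t.dom.nodes.Finite → ∀ s S,
      (f t.dom (t.valuation s S) t.dom.root ↔ p t s S)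

section Recognized

variable {p q : ∀ t : Tree K P, (ℕ → t.dom.nodes) → (ℕ → Set t.dom.nodes) → Prop}

theorem Recognized.congr (hp : Recognized p) (h : ∀ t s S, p t s S ↔ q t s S) : Recognized q := by
  obtain ⟨f, hf, H⟩ := hp
  exact ⟨f, hf, fun t ht s S => (H t ht s S).trans (h t s S)⟩

theorem Recognized.not (hp : Recognized p) : Recognized fun t s S => ¬ p t s S := by
  obtain ⟨f, hf, H⟩ := hp
  exact ⟨_, hf.not, fun t ht s S => not_congr (H t ht s S)⟩

theorem Recognized.and (hp : Recognized p) (hq : Recognized q) :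
    Recognized fun t s S => p t s S ∧ q t s S := by
  obtain ⟨f, hf, H⟩ := hp
  obtain ⟨g, hg, H'⟩ := hq
  exact ⟨_, hf.and hg, fun t ht s S => and_congr (H t ht s S) (H' t ht s S)⟩

theorem Recognized.or (hp : Recognized p) (hq : Recognized q) :
    Recognized fun t s S => p t s S ∨ q t s S := by
  obtain ⟨f, hf, H⟩ := hp
  obtain ⟨g, hg, H'⟩ := hq
  exact ⟨_, hf.or hg, fun t ht s S => or_congr (H t ht s S) (H' t ht s S)⟩

theorem Recognized.imp (hp : Recognized p) (hq : Recognized q) :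
    Recognized fun t s S => p t s S → q t s S :=
  (hp.not.or hq).congr fun _ _ _ => imp_iff_not_or.symm

theorem Recognized.exSet (hp : Recognized p) (X : ℕ) :
    Recognized fun t s S => ∃ A, p t s (Function.update S X A) := by
  obtain ⟨f, hf, H⟩ := hp
  refine ⟨_, hf.exists_set (.setVar X), fun t ht s S => exists_congr fun A => ?_⟩
  rw [← t.valuation_update_setVar, H t ht]

theorem Recognized.ex (hp : Recognized p) (x : ℕ) :
    Recognized fun t s S => ∃ a, p t (Function.update s x a) S := by
  obtain ⟨f, hf, H⟩ := hp
  obtain ⟨g, hg, Hg⟩ := exists_bottomUp_singleton (Idx.var x : Idx K P)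
  -- An individual quantifier is a set quantifier restricted to singletons.
  refine ⟨_, (hg.and hf).exists_set (.var x), fun t ht s S => ?_⟩
  simp only [Hg, Function.update_self]
  constructor
  · rintro ⟨B, ⟨a, rfl⟩, h⟩
    exact ⟨a, by rwa [← H t ht, t.valuation_update_var]⟩
  · rintro ⟨a, h⟩
    exact ⟨{a}, ⟨a, rfl⟩, by rwa [← t.valuation_update_var, H t ht]⟩

theorem Recognized.allSet (hp : Recognized p) (X : ℕ) :
    Recognized fun t s S => ∀ A, p t s (Function.update S X A) :=
  (hp.not.exSet X).not.congr fun _ _ _ => by simp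

theorem Recognized.all (hp : Recognized p) (x : ℕ) :
    Recognized fun t s S => ∀ a, p t (Function.update s x a) S :=
  (hp.not.ex x).not.congr fun _ _ _ => by simp

end Recognized

theorem recognized_mem (i : Idx K P) (a : Term K) :
    Recognized fun (t : Tree K P) s S => a.val t.toModel s ∈ t.valuation s S i := by
  refine ⟨_, ((bottomUp_mem a.idx).and (bottomUp_mem i)).below, fun t _ s S => ?_⟩
  simp only [Tree.valuation_idx]
  exact ⟨fun ⟨v, _, h, h'⟩ => h ▸ h', fun h => ⟨_, List.nil_prefix, rfl, h⟩⟩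

theorem recognized_dominates (a b : Term K) : Recognized fun (t : Tree K P) s _ =>
    t.toModel.dominates (a.val t.toModel s) (b.val t.toModel s) := by
  refine ⟨_, ((bottomUp_mem a.idx).and (bottomUp_mem b.idx).below).below, fun t _ s S => ?_⟩
  simp only [Tree.valuation_idx]
  constructor
  · rintro ⟨_, -, rfl, _, ⟨v, hv⟩, rfl⟩
    exact ⟨v, hv.symm⟩
  · rintro ⟨v, hv⟩
    exact ⟨_, List.nil_prefix, rfl, _, ⟨v, hv.symm⟩, rfl⟩

theorem recognized_parent (a b : Term K) : Recognized fun (t : Tree K P) s _ =>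
    t.toModel.parent (a.val t.toModel s) (b.val t.toModel s) := by
  refine ⟨_, ((bottomUp_mem a.idx).and (bottomUp_mem b.idx).exists_child).below,
    fun t _ s S => ?_⟩
  simp only [Tree.valuation_idx]
  constructor
  · rintro ⟨_, -, rfl, i, hi, h⟩
    exact ⟨i, (congrArg Subtype.val h).symm⟩
  · rintro ⟨i, hi⟩
    exact ⟨_, List.nil_prefix, rfl, i, hi ▸ (b.val t.toModel s).2, Subtype.ext hi.symm⟩

theorem recognized_leftOf (a b : Term K) : Recognized fun (t : Tree K P) s _ =>
    t.toModel.leftOf (a.val t.toModel s) (b.val t.toModel s) := by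
  refine ⟨_, ((bottomUp_mem a.idx).below.exists_child_lt_child (bottomUp_mem b.idx).below).below,
    fun t _ s S => ?_⟩
  simp only [Tree.valuation_idx]
  constructor
  · rintro ⟨u, -, i, j, hi, hj, hij, ⟨_, ⟨v, hv⟩, rfl⟩, _, ⟨w, hw⟩, rfl⟩
    exact ⟨u, v, w, i, j, hij, hv.symm, hw.symm⟩
  · rintro ⟨u, v, w, i, j, hij, hv, hw⟩
    have hi : u ++ [i] ∈ t.dom.nodes := t.dom.td1 _ v (hv ▸ (a.val t.toModel s).2)
    have hj : u ++ [j] ∈ t.dom.nodes := t.dom.td1 _ w (hw ▸ (b.val t.toModel s).2)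
    exact ⟨⟨u, t.dom.td1 _ _ hi⟩, List.nil_prefix, i, j, hi, hj, hij,
      ⟨_, ⟨v, hv.symm⟩, rfl⟩, _, ⟨w, hw.symm⟩, rfl⟩

theorem recognized_equal (a b : Term K) : Recognized fun (t : Tree K P) s _ =>
    a.val t.toModel s = b.val t.toModel s :=
  (recognized_mem b.idx a).congr fun t s S => by rw [Tree.valuation_idx]; rfl

theorem Formula.recognized (φ : Formula K P) : Recognized fun t s S => φ.Sat t.toModel s S := by
  induction φ with
  | parent a b => exact recognized_parent a b
  | dominates a b => exact recognized_dominates a b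
  | properlyDominates a b => exact (recognized_dominates a b).and (recognized_equal a b).not
  | leftOf a b => exact recognized_leftOf a b
  | equal a b => exact recognized_equal a b
  | pred p a => exact recognized_mem (.pred p) a
  | mem X a => exact recognized_mem (.setVar X) a
  | not φ ih => exact ih.not
  | and φ ψ ih ih' => exact ih.and ih'
  | or φ ψ ih ih' => exact ih.or ih'
  | imp φ ψ ih ih' => exact ih.imp ih'
  | iff φ ψ ih ih' => exact ((ih.imp ih').and (ih'.imp ih)).congr fun _ _ _ => iff_def.symm
  | all x φ ih => exact ih.all x
  | ex x φ ih => exact ih.ex x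
  | allSet X φ ih => exact ih.allSet X
  | exSet X φ ih => exact ih.exSet X

/-! ### Sentences -/

theorem Term.val_congr (M : Model K P) {s s' : ℕ → M.U} (a : Term K)
    (h : ∀ x ∈ a.vars, s x = s' x) : a.val M s = a.val M s' := by
  cases a with
  | var x => exact h x rfl
  | const k => rfl

theorem Formula.sat_congr (M : Model K P) (φ : Formula K P) {s s' : ℕ → M.U}
    {S S' : ℕ → Set M.U} (hs : ∀ x ∈ φ.freeVars, s x = s' x)
    (hS : ∀ X ∈ φ.freeSetVars, S X = S' X) : φ.Sat M s S ↔ φ.Sat M s' S' := by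
  have upd : ∀ {α : Type} {s s' : ℕ → α} {A : Set ℕ} {x : ℕ} (a : α),
      (∀ y ∈ A \ {x}, s y = s' y) →
        ∀ y ∈ A, Function.update s x a y = Function.update s' x a y := by
    intro α s s' A x a h y hy
    by_cases hyx : y = x
    · simp [hyx]
    · simp [hyx, h y ⟨hy, hyx⟩]
  induction φ generalizing s s' S S' with
  | parent a b | dominates a b | properlyDominates a b | leftOf a b | equal a b =>
    simp only [Sat, a.val_congr M fun x hx => hs x (Or.inl hx),
      b.val_congr M fun x hx => hs x (Or.inr hx)]
  | pred p a => simp only [Sat, a.val_congr M hs]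
  | mem X a => simp only [Sat, a.val_congr M hs, hS X rfl]
  | not φ ih => exact not_congr (ih hs hS)
  | and φ ψ ih ih' | or φ ψ ih ih' | imp φ ψ ih ih' | iff φ ψ ih ih' =>
    simp only [Sat, ih (fun x hx => hs x (Or.inl hx)) fun x hx => hS x (Or.inl hx),
      ih' (fun x hx => hs x (Or.inr hx)) fun x hx => hS x (Or.inr hx)]
  | all x φ ih => exact forall_congr' fun a => ih (upd a hs) hS
  | ex x φ ih => exact exists_congr fun a => ih (upd a hs) hS
  | allSet X φ ih => exact forall_congr' fun A => ih hs (upd A hS)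
  | exSet X φ ih => exact exists_congr fun A => ih hs (upd A hS)

theorem Formula.IsSentence.models_iff {φ : Formula K P} (hφ : φ.IsSentence) (M : Model K P)
    (s : ℕ → M.U) (S : ℕ → Set M.U) : M.Models φ ↔ φ.Sat M s S :=
  ⟨fun h => h s S, fun h s' S' => (φ.sat_congr M (by simp [hφ.1]) (by simp [hφ.2])).1 h⟩

/-! ### Definable sets are projections -/

/-- The unary predicates of a labelled tree, all individual variables naming the root. -/
def LabeledTree.valuation (t : LabeledTree (Set P × Set K)) : Idx K P → Set t.dom.nodes
  | .pred p => {u | p ∈ (t.label u).1}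
  | .const k => {u | k ∈ (t.label u).2}
  | .var _ => {t.dom.root}
  | .setVar _ => ∅

theorem Tree.valuation_toLabeled (t : Tree K P) :
    t.toLabeled.valuation = t.valuation (fun _ => t.dom.root) fun _ => ∅ := by
  funext i
  cases i with
  | const k => ext u; exact eq_comm
  | _ => rfl

/-- The indices of the predicates that hold of a node with label `a`. -/
def labelIdx (a : Set P × Set K) (isRoot : Prop) : Set (Idx K P) :=
  {i | match i with
    | .pred p => p ∈ a.1
    | .const k => k ∈ a.2
    | .var _ => isRoot
    | .setVar _ => False}

theorem LabeledTree.setOf_mem_valuation (t : LabeledTree (Set P × Set K)) (u : t.dom.nodes) :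
    {i | u ∈ t.valuation i} = labelIdx (t.label u) (u = t.dom.root) := by
  ext i
  cases i <;> rfl

/-- No information is lost: `I k` is recovered as the node whose label contains `k`. -/
theorem Tree.toLabeled_injective : Function.Injective (Tree.toLabeled (K := K) (P := P)) := by
  rintro ⟨dom, I, R⟩ ⟨dom', I', R'⟩ h
  simp only [Tree.toLabeled, LabeledTree.mk.injEq] at h
  obtain ⟨rfl, h⟩ := h
  have h := fun u => congrFun (eq_of_heq h) u
  simp only [Prod.mk.injEq, Set.ext_iff, Set.mem_ofPred_eq] at h
  congr 1
  · funext k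
    exact (((h (I k)).2 k).1 rfl).symm
  · funext p
    ext u
    exact (h u).1 p

theorem LabeledTree.exists_tree (t : LabeledTree (Set P × Set K))
    (h : ∀ k, ∃ a, t.valuation (.const k) = {a}) : ∃ t' : Tree K P, t'.toLabeled = t := by
  obtain ⟨dom, label⟩ := t
  choose I hI using h
  refine ⟨⟨dom, I, fun p => {u | p ∈ (label u).1}⟩, ?_⟩
  simp only [Tree.toLabeled, LabeledTree.mk.injEq, heq_eq_eq, true_and]
  funext u
  refine Prod.ext rfl ?_
  ext k
  have := Set.ext_iff.1 (hI k) u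
  exact eq_comm.trans this.symm

/-- Besides the sentences, the automaton must check that each constant occurs in exactly one label,
for otherwise the labelled tree comes from no tree. The sentences ignore the assignment, so the
fixed one in `LabeledTree.valuation` may be used. -/
theorem exists_bottomUp_mem_toLabeled [Finite K] {S : Set (Tree K P)} (hfin : AllFinite S)
    (hS : Definable S) : ∃ f : ∀ T : TreeDomain, (Idx K P → Set T.nodes) → T.nodes → Prop,
      BottomUp f ∧ ∀ t : LabeledTree (Set P × Set K), t.dom.nodes.Finite →
        (f t.dom t.valuation t.dom.root ↔ t ∈ Tree.toLabeled '' S) := by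
  obtain ⟨Φ, hΦ, hsent, rfl⟩ := hS
  have := hΦ.to_subtype
  choose f hf Hf using fun φ : Φ => (φ : Formula K P).recognized
  choose g hg Hg using fun k : K => exists_bottomUp_singleton (Idx.const k : Idx K P)
  refine ⟨_, (BottomUp.forall_finite hf).and (BottomUp.forall_finite hg), fun t ht => ?_⟩
  simp only [Hg]
  constructor
  · rintro ⟨h1, h2⟩
    obtain ⟨t, rfl⟩ := t.exists_tree h2
    refine ⟨t, fun φ hφ => ?_, rfl⟩
    have := h1 ⟨φ, hφ⟩
    rw [Tree.valuation_toLabeled] at this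
    exact ((hsent φ hφ).models_iff _ _ _).2 ((Hf ⟨φ, hφ⟩ t ht _ _).1 this)
  · rintro ⟨t, htS, rfl⟩
    refine ⟨fun φ => ?_, fun k => ⟨t.I k, ?_⟩⟩
    · rw [Tree.valuation_toLabeled]
      exact (Hf φ t ht _ _).2 (htS φ φ.2 _ _)
    · rw [Tree.valuation_toLabeled]
      rfl

/-! ### From automata to grammars -/

section Grammar

variable {A Q : Type}

/-- The lists of labels with states that a start symbol `inl a`, or a nonterminal
`inr (a, q)`, may have as children. -/
def ValidChildren (lab : A → Prop → Set (Idx K P)) (δ : Set (Idx K P) → List Q → Q)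
    (o : Q → Prop) : A ⊕ A × Q → List (A × Q) → Prop
  | .inl a, l => o (δ (lab a True) (l.map Prod.snd))
  | .inr (a, q), l => q = δ (lab a False) (l.map Prod.snd)

/-- The production with the given left-hand side and right-hand side. -/
def production (x : (A ⊕ A × Q) × List (A × Q)) : ContextFreeRule Empty (A ⊕ A × Q) :=
  ⟨x.1, x.2.map fun c => Symbol.nonterminal (Sum.inr c)⟩

/-- Here the branching bound makes the grammar finite: there are finitely many words of length at
most `n`. -/
theorem finite_productions [Finite A] [Finite Q] (n : ℕ)
    (p : (A ⊕ A × Q) → List (A × Q) → Prop) :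
    (production '' {x : (A ⊕ A × Q) × List (A × Q) | x.2.length ≤ n ∧ p x.1 x.2}).Finite := by
  refine Set.Finite.image _ ?_
  refine (Set.finite_univ.prod (List.finite_length_le (A × Q) n)).subset ?_
  exact fun x hx => ⟨trivial, hx.1⟩

/-- The label that a nonterminal projects to. -/
def projectSymbol {B : Type*} (π : A → B) : Symbol Empty (A ⊕ A × Q) → B
  | .nonterminal (.inl a) => π a
  | .nonterminal (.inr (a, _)) => π a

/-- The root needs its own nonterminals `inl a`: it alone reads the variables, which all name it,
and it alone must be accepting. Terminals are not needed, since a leaf is expanded by an empty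
production. The labels are recoded in `Fin m` to keep the alphabet in `Type`. -/
theorem exists_grammar [Finite K] [Finite P]
    {f : ∀ T : TreeDomain, (Idx K P → Set T.nodes) → T.nodes → Prop} (hf : BottomUp f) (n : ℕ) :
    ∃ (N : Type) (_ : Finite N) (start : Set P × Set K → N) (R : Finset (ContextFreeRule Empty N))
      (π : Symbol Empty N → Set P × Set K), ∀ a, LabeledTree.map π '' derivationTrees (start a) R =
        {t | t.dom.nodes.Finite ∧ (∀ (u : List ℕ) (i : ℕ), u ++ [i] ∈ t.dom.nodes → i < n) ∧
          t.label t.dom.root = a ∧ f t.dom t.valuation t.dom.root} := by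
  obtain ⟨Q, _, δ, o, H⟩ := hf
  obtain ⟨m, ⟨e⟩⟩ := Finite.exists_equiv_fin (Set P × Set K)
  let valid := ValidChildren (fun a => labelIdx (K := K) (P := P) (e.symm a)) δ o
  refine ⟨Fin m ⊕ Fin m × Q, inferInstance, fun a => .inl (e a), (finite_productions n valid).toFinset,
    projectSymbol e.symm, fun a => ?_⟩
  ext t
  constructor
  · rintro ⟨d, ⟨hfin, hroot, -, hd⟩, rfl⟩
    obtain ⟨ρ, hρ, ho⟩ := H d.dom hfin (d.map (projectSymbol e.symm)).valuation
    have hrun : ∀ (u : d.dom.nodes) (l : List Q), d.dom.ChildList u ρ l →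
        ρ u = δ (labelIdx (projectSymbol e.symm (d.label u)) (u = d.dom.root)) l := by
      intro u l hl
      refine (hρ u l hl).trans (congrArg (δ · l) ?_)
      exact (d.map (projectSymbol e.symm)).setOf_mem_valuation u
    have hrule : ∀ (u : d.dom.nodes) X, d.label u = Symbol.nonterminal X →
        ∃ l : List (Fin m × Q), l.length ≤ n ∧ valid X l ∧ d.dom.ChildList u d.label
          (l.map fun c => Symbol.nonterminal (Sum.inr c)) := by
      intro u X hX
      obtain ⟨r, hr, rfl, h1, h2⟩ := hd u X hX
      simp only [Set.Finite.mem_toFinset] at hr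
      obtain ⟨⟨X, l⟩, ⟨hl, hv⟩, rfl⟩ := hr
      exact ⟨l, hl, hv, h1, h2⟩
    have hstate : ∀ (u : d.dom.nodes) (l : List (Fin m × Q)), d.dom.ChildList u d.label
        (l.map fun c => Symbol.nonterminal (Sum.inr c)) →
        (∀ (i : ℕ) (hi : (u : List ℕ) ++ [i] ∈ d.dom.nodes) (c : Fin m × Q),
          d.label ⟨_, hi⟩ = Symbol.nonterminal (Sum.inr c) → c.2 = ρ ⟨_, hi⟩) →
        d.dom.ChildList u ρ (l.map Prod.snd) := by
      intro u l hl ih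
      refine ⟨by simpa using hl.1, fun i hi => ?_⟩
      have := hl.2 i hi
      rw [List.getElem?_map, Option.map_eq_some_iff] at this ⊢
      obtain ⟨c, hc, hci⟩ := this
      exact ⟨c, hc, ih i hi c hci.symm⟩
    -- The states guessed by the grammar are those of the actual run, by induction from the leaves
    -- upwards.
    have hinr : ∀ (u : d.dom.nodes) (c : Fin m × Q),
        d.label u = Symbol.nonterminal (Sum.inr c) → c.2 = ρ u := by
      intro u
      induction u using TreeDomain.induction_of_finite hfin with
      | step u ih =>
        rintro ⟨b, q⟩ hc
        obtain ⟨l, -, hv, hl⟩ := hrule u _ hc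
        have hne : u ≠ d.dom.root := by
          rintro rfl
          rw [hroot] at hc
          simp at hc
        rw [hrun u _ (hstate u l hl ih), hc]
        simpa [hne, projectSymbol, valid, ValidChildren] using hv
    refine ⟨hfin, fun u i hi => ?_, ?_, ?_⟩
    · let v : d.dom.nodes := ⟨u, d.dom.td1 _ _ hi⟩
      cases hX : d.label v with
      | terminal x => exact x.elim
      | nonterminal X =>
        obtain ⟨l, hl, -, hc⟩ := hrule v X hX
        have := (hc.1 i).1 hi
        rw [List.length_map] at this
        exact this.trans_le hl
    · change projectSymbol e.symm (d.label d.dom.root) = a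
      simp [hroot, projectSymbol]
    · obtain ⟨l, -, hv, hl⟩ := hrule _ _ hroot
      have := hrun d.dom.root _ (hstate _ l hl fun i hi => hinr _)
      refine (ho d.dom.root).mpr ?_
      rw [this, hroot]
      simpa [projectSymbol, valid, ValidChildren] using hv
  · rintro ⟨hfin, hbd, rfl, hft⟩
    obtain ⟨ρ, hρ, ho⟩ := H t.dom hfin t.valuation
    classical
    -- Conversely, writing the states of the run into the tree gives a derivation tree.
    let lab : t.dom.nodes → Fin m ⊕ Fin m × Q := fun u =>
      if u = t.dom.root then .inl (e (t.label u)) else .inr (e (t.label u), ρ u)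
    refine ⟨⟨t.dom, fun u => .nonterminal (lab u)⟩, ⟨hfin, by simp [lab], fun u x => x.elim, ?_⟩, ?_⟩
    · rintro u X hX
      obtain rfl : lab u = X := by simpa using hX
      obtain ⟨l, hl⟩ := t.dom.exists_childList hfin u fun v => (e (t.label v), ρ v)
      have hρu := hρ u _ (hl.map Prod.snd)
      rw [LabeledTree.setOf_mem_valuation] at hρu
      have hout := (hl.map fun c => (Symbol.nonterminal (Sum.inr c) :
        Symbol Empty (Fin m ⊕ Fin m × Q))).congr (g := fun u => .nonterminal (lab u)) (by
          intro i hi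
          have : (⟨_, hi⟩ : t.dom.nodes) ≠ t.dom.root := by
            intro h
            simpa [TreeDomain.root] using congrArg Subtype.val h
          simp [lab, this])
      refine ⟨production (lab u, l), ?_, rfl, hout.1, hout.2⟩
      simp only [Set.Finite.mem_toFinset]
      refine ⟨_, ⟨?_, ?_⟩, rfl⟩
      · by_contra! hlt
        exact (hbd u n ((hl.1 n).2 hlt)).false
      · by_cases hu : u = t.dom.root
        · subst hu
          have := (ho t.dom.root).mp hft
          rw [hρu] at this
          simpa [valid, lab, ValidChildren] using this
        · simpa [valid, lab, hu, ValidChildren] using hρu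
    · obtain ⟨dom, label⟩ := t
      simp only [LabeledTree.map, LabeledTree.mk.injEq, heq_eq_eq, true_and]
      funext u
      by_cases hu : u = dom.root <;> simp [lab, hu, projectSymbol]

end Grammar

theorem Definable.exists_grammar [Finite K] [Finite P] {S : Set (Tree K P)} (hfin : AllFinite S)
    (hbd : BoundedBranching S) (hS : Definable S) :
    ∃ (N : Type) (_ : Finite N) (start : Set P × Set K → N) (R : Finset (ContextFreeRule Empty N))
      (π : Symbol Empty N → Set P × Set K), ∀ a, LabeledTree.map π '' derivationTrees (start a) R =
        {t | t ∈ Tree.toLabeled '' S ∧ t.label t.dom.root = a} := by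
  obtain ⟨f, hf, H⟩ := exists_bottomUp_mem_toLabeled hfin hS
  obtain ⟨n, hn⟩ := hbd
  obtain ⟨N, hN, start, R, π, h⟩ := LKP.exists_grammar hf n
  refine ⟨N, hN, start, R, π, fun a => ?_⟩
  rw [h]
  ext t
  constructor
  · rintro ⟨h1, -, h3, h4⟩
    exact ⟨(H t h1).1 h4, h3⟩
  · rintro ⟨h1, h2⟩
    have ht : t.dom.nodes.Finite ∧ ∀ (u : List ℕ) (i : ℕ), u ++ [i] ∈ t.dom.nodes → i < n := by
      obtain ⟨t, ht, rfl⟩ := h1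
      exact ⟨hfin t ht, hn t ht⟩
    exact ⟨ht.1, ht.2, h2, (H t ht.1).2 h1⟩

theorem Definable.isProjectionOfLocal [Finite K] [Finite P] {S : Set (Tree K P)}
    (hfin : AllFinite S) (hbd : BoundedBranching S) (hS : Definable S) :
    IsProjectionOfLocal S := by
  obtain ⟨N, hN, start, R, π, h⟩ := hS.exists_grammar hfin hbd
  refine ⟨Empty, N, inferInstance, hN, Set.range fun a => (start a, R), π, Set.finite_range _, ?_⟩
  simp only [Set.biUnion_range, Set.image_iUnion, h]
  ext t
  simp

theorem Definable.isProjectionOfCFG [Finite K] [Finite P] {S : Set (Tree K P)}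
    (hfin : AllFinite S) (hbd : BoundedBranching S) (hS : Definable S) (hroot : SameRootLabel S) :
    IsProjectionOfCFG S := by
  obtain ⟨N, hN, start, R, π, h⟩ := hS.exists_grammar hfin hbd
  obtain ⟨a, ha⟩ : ∃ a, ∀ t ∈ S, t.toLabeled.label t.toLabeled.dom.root = a := by
    rcases S.eq_empty_or_nonempty with rfl | ⟨t, ht⟩
    -- For empty `S` any label will do: the grammar then has no derivation tree.
    · exact ⟨(∅, ∅), by simp⟩
    · exact ⟨_, fun t' ht' => hroot t' ht' t ht⟩
  refine ⟨Empty, N, inferInstance, hN, start a, R, π, ?_⟩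
  rw [h]
  ext t
  constructor
  · rintro ⟨t, ht, rfl⟩
    exact ⟨⟨t, ht, rfl⟩, ha t ht⟩
  · exact And.left

/-! ### Expressible properties -/

theorem Term.finite_vars (a : Term K) : a.vars.Finite := by
  cases a <;> simp [Term.vars]

theorem Formula.finite_freeVars (φ : Formula K P) : φ.freeVars.Finite := by
  induction φ with
  | all x φ ih | ex x φ ih => exact ih.subset Set.sdiff_subset
  | allSet X φ ih | exSet X φ ih => exact ih
  | not φ ih => exact ih
  | and φ ψ ih ih' | or φ ψ ih ih' | imp φ ψ ih ih' | iff φ ψ ih ih' => exact ih.union ih'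
  | pred p a | mem X a => exact a.finite_vars
  | _ => exact (Term.finite_vars _).union (Term.finite_vars _)

theorem Formula.finite_freeSetVars (φ : Formula K P) : φ.freeSetVars.Finite := by
  induction φ with
  | allSet x φ ih | exSet x φ ih => exact ih.subset Set.sdiff_subset
  | all X φ ih | ex X φ ih => exact ih
  | not φ ih => exact ih
  | and φ ψ ih ih' | or φ ψ ih ih' | imp φ ψ ih ih' | iff φ ψ ih ih' => exact ih.union ih'
  | mem X a => exact Set.finite_singleton X
  | _ => exact Set.finite_empty

theorem Model.models_all (M : Model K P) (x : ℕ) (φ : Formula K P) :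
    M.Models (.all x φ) ↔ M.Models φ :=
  ⟨fun h s S => by simpa using h s S (s x), fun h s S a => h _ S⟩

theorem Model.models_allSet (M : Model K P) (X : ℕ) (φ : Formula K P) :
    M.Models (.allSet X φ) ↔ M.Models φ :=
  ⟨fun h s S => by simpa using h s S (S X), fun h s S A => h s _⟩

/-- Every formula has a universal closure. -/
theorem Formula.exists_isSentence (φ : Formula K P) :
    ∃ ψ : Formula K P, ψ.IsSentence ∧ ∀ M : Model K P, M.Models ψ ↔ M.Models φ := by
  have h1 : ∀ A : Set ℕ, A.Finite → ∀ φ : Formula K P, φ.freeVars ⊆ A →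
      ∃ ψ : Formula K P, ψ.freeVars = ∅ ∧ ∀ M : Model K P, M.Models ψ ↔ M.Models φ := by
    intro A hA
    induction A, hA using Set.Finite.induction_on with
    | empty => exact fun φ h => ⟨φ, Set.subset_empty_iff.1 h, fun _ => Iff.rfl⟩
    | @insert x A _ _ ih =>
      intro φ h
      obtain ⟨ψ, hψ, H⟩ := ih (.all x φ) (by simpa [freeVars, Set.sdiff_singleton_subset_iff] using h)
      exact ⟨ψ, hψ, fun M => (H M).trans (M.models_all x φ)⟩
  have h2 : ∀ A : Set ℕ, A.Finite → ∀ φ : Formula K P, φ.freeVars = ∅ → φ.freeSetVars ⊆ A →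
      ∃ ψ : Formula K P, ψ.IsSentence ∧ ∀ M : Model K P, M.Models ψ ↔ M.Models φ := by
    intro A hA
    induction A, hA using Set.Finite.induction_on with
    | empty => exact fun φ h0 h => ⟨φ, ⟨h0, Set.subset_empty_iff.1 h⟩, fun _ => Iff.rfl⟩
    | @insert X A _ _ ih =>
      intro φ h0 h
      obtain ⟨ψ, hψ, H⟩ := ih (.allSet X φ) h0
        (by simpa [freeSetVars, Set.sdiff_singleton_subset_iff] using h)
      exact ⟨ψ, hψ, fun M => (H M).trans (M.models_allSet X φ)⟩
  obtain ⟨ψ, hψ, H⟩ := h1 _ φ.finite_freeVars φ subset_rfl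
  obtain ⟨χ, hχ, H'⟩ := h2 _ ψ.finite_freeSetVars ψ hψ subset_rfl
  exact ⟨χ, hχ, fun M => (H' M).trans (H M)⟩

/-- A property of trees with assignments that some formula expresses. -/
def Expressible (p : ∀ t : Tree K P, (ℕ → t.dom.nodes) → (ℕ → Set t.dom.nodes) → Prop) : Prop :=
  ∃ φ : Formula K P, ∀ (t : Tree K P) s S, φ.Sat t.toModel s S ↔ p t s S

/-- The expressing formula may have free variables, but its truth does not depend on them, so its
universal closure defines the same set. -/
theorem definable_of_expressible {S : Set (Tree K P)}
    (h : Expressible fun (t : Tree K P) _ _ => t ∈ S) : Definable S := by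
  obtain ⟨φ, hφ⟩ := h
  obtain ⟨ψ, hψ, H⟩ := φ.exists_isSentence
  refine ⟨{ψ}, Set.finite_singleton _, by simpa using hψ, ?_⟩
  ext t
  simp only [Mod, Set.mem_singleton_iff, forall_eq, Set.mem_ofPred_eq, H]
  exact ⟨fun ht s S => (hφ t s S).2 ht,
    fun ht => (hφ t (fun _ => t.dom.root) fun _ => ∅).1 (ht _ _)⟩

namespace Expressible

variable {p q : ∀ t : Tree K P, (ℕ → t.dom.nodes) → (ℕ → Set t.dom.nodes) → Prop}

theorem congr (hp : Expressible p) (h : ∀ t s S, p t s S ↔ q t s S) : Expressible q := by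
  obtain ⟨φ, hφ⟩ := hp
  exact ⟨φ, fun t s S => (hφ t s S).trans (h t s S)⟩

theorem not (hp : Expressible p) : Expressible fun t s S => ¬ p t s S := by
  obtain ⟨φ, hφ⟩ := hp
  exact ⟨.not φ, fun t s S => not_congr (hφ t s S)⟩

theorem and (hp : Expressible p) (hq : Expressible q) :
    Expressible fun t s S => p t s S ∧ q t s S := by
  obtain ⟨φ, hφ⟩ := hp
  obtain ⟨ψ, hψ⟩ := hq
  exact ⟨.and φ ψ, fun t s S => and_congr (hφ t s S) (hψ t s S)⟩

theorem imp (hp : Expressible p) (hq : Expressible q) :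
    Expressible fun t s S => p t s S → q t s S := by
  obtain ⟨φ, hφ⟩ := hp
  obtain ⟨ψ, hψ⟩ := hq
  exact ⟨.imp φ ψ, fun t s S => imp_congr (hφ t s S) (hψ t s S)⟩

theorem iff (hp : Expressible p) (hq : Expressible q) :
    Expressible fun t s S => (p t s S ↔ q t s S) := by
  obtain ⟨φ, hφ⟩ := hp
  obtain ⟨ψ, hψ⟩ := hq
  exact ⟨.iff φ ψ, fun t s S => iff_congr (hφ t s S) (hψ t s S)⟩

theorem all (hp : Expressible p) (x : ℕ) :
    Expressible fun t s S => ∀ a, p t (Function.update s x a) S := by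
  obtain ⟨φ, hφ⟩ := hp
  exact ⟨.all x φ, fun t s S => forall_congr' fun a => hφ t _ S⟩

theorem ex (hp : Expressible p) (x : ℕ) :
    Expressible fun t s S => ∃ a, p t (Function.update s x a) S := by
  obtain ⟨φ, hφ⟩ := hp
  exact ⟨.ex x φ, fun t s S => exists_congr fun a => hφ t _ S⟩

theorem allSet (hp : Expressible p) (X : ℕ) :
    Expressible fun t s S => ∀ A, p t s (Function.update S X A) := by
  obtain ⟨φ, hφ⟩ := hp
  exact ⟨.allSet X φ, fun t s S => forall_congr' fun A => hφ t s _⟩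

theorem exSet (hp : Expressible p) (X : ℕ) :
    Expressible fun t s S => ∃ A, p t s (Function.update S X A) := by
  obtain ⟨φ, hφ⟩ := hp
  exact ⟨.exSet X φ, fun t s S => exists_congr fun A => hφ t s _⟩

theorem const (c : Prop) : Expressible fun (_ : Tree K P) _ _ => c := by
  by_cases h : c
  · exact ⟨.all 0 (.equal (.var 0) (.var 0)), fun t s S => iff_of_true (fun _ => rfl) h⟩
  · exact ⟨.all 0 (.not (.equal (.var 0) (.var 0))), fun t s S =>
      iff_of_false (fun H => H t.dom.root rfl) h⟩

theorem forall_finite {κ : Type*} [Finite κ]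
    {p : κ → ∀ t : Tree K P, (ℕ → t.dom.nodes) → (ℕ → Set t.dom.nodes) → Prop}
    (hp : ∀ k, Expressible (p k)) : Expressible fun t s S => ∀ k, p k t s S := by
  classical
  have := Fintype.ofFinite κ
  have key : ∀ s : Finset κ, Expressible fun t r S => ∀ k ∈ s, p k t r S := by
    intro s
    induction s using Finset.induction_on with
    | empty => simpa using const True
    | insert a s _ ih => simpa only [Finset.forall_mem_insert] using (hp a).and ih
  simpa using key Finset.univ

theorem exists_finite {κ : Type*} [Finite κ]
    {p : κ → ∀ t : Tree K P, (ℕ → t.dom.nodes) → (ℕ → Set t.dom.nodes) → Prop}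
    (hp : ∀ k, Expressible (p k)) : Expressible fun t s S => ∃ k, p k t s S :=
  (forall_finite fun k => (hp k).not).not.congr fun t s S => by simp

theorem mem (X x : ℕ) : Expressible fun (_ : Tree K P) s S => s x ∈ S X :=
  ⟨.mem X (.var x), fun _ _ _ => Iff.rfl⟩

theorem child (x y : ℕ) : Expressible fun (_ : Tree K P) s _ =>
    ∃ i : ℕ, (s y : List ℕ) = (s x : List ℕ) ++ [i] :=
  ⟨.parent (.var x) (.var y), fun _ _ _ => Iff.rfl⟩

/-- The root is the only node that dominates every node. -/
theorem isRoot (x : ℕ) : Expressible fun (t : Tree K P) s _ => s x = t.dom.root := by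
  have : Expressible fun (t : Tree K P) s S => ∀ a : t.dom.nodes,
      t.toModel.dominates (Function.update s (x + 1) a x) (Function.update s (x + 1) a (x + 1)) :=
    all (p := fun t s S => t.toModel.dominates (s x) (s (x + 1)))
      ⟨.dominates (.var x) (.var (x + 1)), fun _ _ _ => Iff.rfl⟩ (x + 1)
  refine this.congr fun t s S => ?_
  simp only [Function.update_self, ne_eq, Nat.left_eq_add, one_ne_zero, not_false_eq_true,
    Function.update_of_ne]
  constructor
  · intro h
    obtain ⟨v, hv⟩ := h t.dom.root
    exact Subtype.ext (List.append_eq_nil_iff.1 hv.symm).1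
  · rintro h a
    exact ⟨a, by simp [h, TreeDomain.root]⟩

/-- Being the `i`-th child is expressible. -/
theorem nthChild (i : ℕ) (y : ℕ) : Expressible fun (_ : Tree K P) s _ =>
    (s (y + 1) : List ℕ) = (s 0 : List ℕ) ++ [i] := by
  induction i using Nat.strong_induction_on generalizing y with
  | _ i ih =>
    have hleft : Expressible fun (t : Tree K P) s _ =>
        t.toModel.leftOf (s (y + 2)) (s (y + 1)) :=
      ⟨.leftOf (.var (y + 2)) (.var (y + 1)), fun _ _ _ => Iff.rfl⟩
    -- A child is the `i`-th if it is not the `j`-th for any `j < i`, while each sibling to its left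
    -- is. The induction is general in `y` because that sibling needs the fresh variable `y + 2`.
    have h1 := forall_finite fun j : Fin i => (ih j j.2 y).not
    have h2 := exists_finite fun j : Fin i => ih j j.2 (y + 1)
    have h3 := (((child 0 (y + 2)).and hleft).imp h2).all (y + 2)
    refine ((child 0 (y + 1)).and (h1.and h3)).congr fun t s S => ?_
    simp only [Function.update_self, Function.update_of_ne (by omega : 0 ≠ y + 2)]
    constructor
    · rintro ⟨⟨k, hk⟩, hne, hlt⟩
      rcases lt_trichotomy k i with hki | rfl | hik
      · exact absurd hk (hne ⟨k, hki⟩)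
      · exact hk
      -- Were the index larger than `i`, the `i`-th sibling would exist, lie to the left, and have
      -- an index below `i`.
      · have hmem : (s 0 : List ℕ) ++ [i] ∈ t.dom.nodes := t.dom.td2 _ k _ (hk ▸ (s _).2) hik
        obtain ⟨j, hj⟩ := hlt ⟨_, hmem⟩ ⟨⟨i, rfl⟩, s 0, [], [], i, k, hik, by simp, by simpa using hk⟩
        have : i = j := by simpa using hj
        exact absurd this j.2.ne'
    · intro hi
      refine ⟨⟨i, hi⟩, fun j hj => ?_, ?_⟩
      · have : i = j := by simpa using hi.symm.trans hj
        exact absurd this j.2.ne'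
      · rintro a ⟨⟨k, hk⟩, u, v, w, a', b', hab, ha, hb⟩
        have hab' : k < i := by
          rw [hk] at ha
          rw [Function.update_of_ne (by omega), hi] at hb
          -- Two siblings can only diverge at their last entry, so `leftOf` compares exactly their
          -- indices.
          have hu : u.length = (s 0 : List ℕ).length := by
            have e1 := congrArg List.length ha
            have e2 := congrArg List.length hb
            by_contra hne
            have hlt : u.length < (s 0 : List ℕ).length := by
              simp only [List.length_append, List.length_singleton] at e1 e2
              omega
            have g1 := congrArg (·[u.length]?) ha
            have g2 := congrArg (·[u.length]?) hb
            simp [List.getElem?_append, hlt] at g1 g2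
            omega
          have l1 := congrArg (·[u.length]?) ha
          have l2 := congrArg (·[u.length]?) hb
          simp [hu] at l1 l2
          omega
        exact ⟨⟨k, hab'⟩, hk⟩

/-- Simultaneous quantification over the set variables below `m`, as needed to guess a labelling. -/
theorem exists_sets (hp : Expressible p) (m : ℕ) : Expressible fun t s S =>
    ∃ S' : ℕ → Set t.dom.nodes, (∀ i, m ≤ i → S' i = S i) ∧ p t s S' := by
  induction m with
  | zero =>
    refine hp.congr fun t s S => ⟨fun h => ⟨S, fun _ _ => rfl, h⟩, ?_⟩
    rintro ⟨S', h, hS'⟩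
    rwa [funext fun i => h i i.zero_le] at hS'
  | succ m ih =>
    refine (ih.exSet m).congr fun t s S => ?_
    constructor
    · rintro ⟨A, S', h, hp⟩
      refine ⟨S', fun i hi => ?_, hp⟩
      rw [h i (by omega), Function.update_of_ne (by omega)]
    · rintro ⟨S', h, hp⟩
      refine ⟨S' m, S', fun i hi => ?_, hp⟩
      by_cases him : i = m
      · simp [him]
      · rw [Function.update_of_ne him, h i (by omega)]

end Expressible

/-! ### Projections of local sets are definable -/

namespace Expressible

/-- Quantification over labellings of the nodes by a finite alphabet is expressible. -/
theorem exists_labelling {B : Type*} [Finite B] {m : ℕ} (e : B ≃ Fin m)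
    {p : ∀ t : Tree K P, (ℕ → t.dom.nodes) → (ℕ → Set t.dom.nodes) → Prop}
    {q : ∀ t : Tree K P, (t.dom.nodes → B) → Prop} (hp : Expressible p)
    (h : ∀ t s S l, (∀ u b, u ∈ S (e b) ↔ l u = b) → (p t s S ↔ q t l)) :
    Expressible fun t _ _ => ∃ l, q t l := by
  -- The sets with indices `e b` partition the nodes; such partitions correspond to labellings.
  have hpart : Expressible fun (t : Tree K P) s S => ∀ a : t.dom.nodes,
      ∃ b : B, Function.update s 0 a 0 ∈ S (e b) ∧
        ∀ b', Function.update s 0 a 0 ∈ S (e b') → b' = b :=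
    (exists_finite fun b : B => (mem (e b) 0).and
      (forall_finite fun b' : B => (mem (e b') 0).imp (const (b' = b)))).all 0
  refine ((hpart.and hp).exists_sets m).congr fun t s S => ?_
  simp only [Function.update_self]
  constructor
  · rintro ⟨S', -, h1, h2⟩
    choose l hl hl' using h1
    exact ⟨l, (h t s S' l fun u b => ⟨fun hb => (hl' u b hb).symm, fun hb => hb ▸ hl u⟩).1 h2⟩
  · rintro ⟨l, hl⟩
    let S' : ℕ → Set t.dom.nodes := fun i => if i < m then {u | (e (l u) : ℕ) = i} else S i
    have key : ∀ u b, u ∈ S' (e b) ↔ l u = b := by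
      intro u b
      simp [S', Fin.val_inj]
    refine ⟨S', fun i hi => if_neg (not_lt.2 hi), fun u => ⟨l u, (key u _).2 rfl, fun b hb =>
      ((key u b).1 hb).symm⟩, (h t s S' l key).2 hl⟩

theorem childInduction : Expressible fun (t : Tree K P) _ _ => ∀ p : Set t.dom.nodes,
      (∀ u : t.dom.nodes, (∀ (i : ℕ) (h : (u : List ℕ) ++ [i] ∈ t.dom.nodes), ⟨_, h⟩ ∈ p) → u ∈ p) →
        ∀ u : t.dom.nodes, u ∈ p := by
  refine (((((((child 0 1).imp (mem 0 1)).all 1).imp (mem 0 0)).all 0).imp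
    ((mem 0 0).all 0)).allSet 0).congr fun t s S => ?_
  simp only [Function.update_self, ne_eq, zero_ne_one, not_false_eq_true, Function.update_of_ne]
  refine forall_congr' fun p => imp_congr (forall_congr' fun u => imp_congr ?_ Iff.rfl) Iff.rfl
  exact ⟨fun h i hi => h _ ⟨i, rfl⟩, fun h ⟨v, hv⟩ ⟨i, hi⟩ => by
    subst hi
    exact h i hv⟩

/-- The children of the node `0` are labelled with the given word. -/
theorem childList {B : Type*} (e : B → ℕ) (w : List B) : Expressible fun (t : Tree K P) s S =>
    (∀ i : ℕ, (s 0 : List ℕ) ++ [i] ∈ t.dom.nodes ↔ i < w.length) ∧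
      ∀ (i : ℕ) (h : (s 0 : List ℕ) ++ [i] ∈ t.dom.nodes), ∃ b, w[i]? = some b ∧ ⟨_, h⟩ ∈ S (e b) := by
  have h1 := ((child (K := K) (P := P) 0 1).imp (exists_finite fun i : Fin w.length =>
    (nthChild i 0).and (mem (e w[i]) 1))).all 1
  have h2 := forall_finite fun i : Fin w.length => (nthChild (K := K) (P := P) i 0).ex 1
  refine (h1.and h2).congr fun t s S => ?_
  simp only [Function.update_self, ne_eq, zero_ne_one, not_false_eq_true, Function.update_of_ne,
    zero_add]
  constructor
  · rintro ⟨h1, h2⟩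
    have h3 : ∀ (i : ℕ) (h : (s 0 : List ℕ) ++ [i] ∈ t.dom.nodes),
        ∃ hi : i < w.length, ⟨_, h⟩ ∈ S (e w[i]) := by
      intro i h
      obtain ⟨j, hj, hm⟩ := h1 ⟨_, h⟩ ⟨i, rfl⟩
      obtain rfl : i = j := by simpa using hj
      exact ⟨j.2, hm⟩
    refine ⟨fun i => ⟨fun h => (h3 i h).1, fun hi => ?_⟩, fun i h => ?_⟩
    · obtain ⟨a, ha⟩ := h2 ⟨i, hi⟩
      exact ha ▸ a.2
    · obtain ⟨hi, hm⟩ := h3 i h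
      exact ⟨_, List.getElem?_eq_getElem hi, hm⟩
  · rintro ⟨h1, h2⟩
    refine ⟨?_, fun i => ⟨⟨_, (h1 i).2 i.2⟩, rfl⟩⟩
    rintro ⟨_, hv⟩ ⟨i, rfl⟩
    obtain ⟨b, hb, hm⟩ := h2 i hv
    obtain ⟨hi, rfl⟩ := List.getElem?_eq_some_iff.1 hb
    exact ⟨⟨i, hi⟩, rfl, hm⟩

/-- The label of the node `0` is expressible. -/
theorem label [Finite K] [Finite P] (a : Set P × Set K) :
    Expressible fun (t : Tree K P) s _ => a = t.toLabeled.label (s 0) := by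
  have h1 := forall_finite fun p : P => iff (const (K := K) (P := P) (p ∈ a.1))
    (q := fun t s _ => s 0 ∈ t.R p) ⟨.pred p (.var 0), fun _ _ _ => Iff.rfl⟩
  have h2 := forall_finite fun k : K => iff (const (K := K) (P := P) (k ∈ a.2))
    (q := fun t s _ => t.I k = s 0) ⟨.equal (.const k) (.var 0), fun _ _ _ => Iff.rfl⟩
  refine (h1.and h2).congr fun t s S => ?_
  simp only [Tree.toLabeled, Prod.ext_iff, Set.ext_iff, Set.mem_ofPred_eq]

end Expressible

/-- This form is ready for translation into a formula: finiteness becomes an induction principle.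
The finite branching that makes the two equivalent is supplied by the productions themselves. -/
theorem isDerivationTree_iff {T : Type*} (G : ContextFreeGrammar T)
    (t : LabeledTree (Symbol T G.NT)) : IsDerivationTree G t ↔
      (∀ p : Set t.dom.nodes, (∀ u : t.dom.nodes,
        (∀ (i : ℕ) (h : (u : List ℕ) ++ [i] ∈ t.dom.nodes), ⟨_, h⟩ ∈ p) → u ∈ p) →
          ∀ u : t.dom.nodes, u ∈ p) ∧
      t.label t.dom.root = Symbol.nonterminal G.initial ∧
      ∀ u : t.dom.nodes, (∀ a : T, t.label u = Symbol.terminal a →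
          t.dom.ChildList u t.label []) ∧
        ∀ A : G.NT, t.label u = Symbol.nonterminal A → ∃ r : G.rules, r.1.input = A ∧
          t.dom.ChildList u t.label r.1.output := by
  have hnil : ∀ u : t.dom.nodes, t.dom.ChildList u t.label [] ↔
      ∀ i : ℕ, (u : List ℕ) ++ [i] ∉ t.dom.nodes := by
    intro u
    simp only [TreeDomain.ChildList, List.length_nil, not_lt_zero, iff_false]
    exact ⟨And.left, fun h => ⟨h, fun i hi => absurd hi (h i)⟩⟩
  simp only [hnil]
  constructor
  · rintro ⟨h1, h2, h3, h4⟩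
    refine ⟨fun p hp => t.dom.induction_of_finite h1 (· ∈ p) hp, h2, fun u => ⟨h3 u, fun A hA => ?_⟩⟩
    obtain ⟨r, hr, h⟩ := h4 u A hA
    exact ⟨⟨r, hr⟩, h⟩
  · rintro ⟨h1, h2, h3⟩
    refine ⟨TreeDomain.finite_of_induction (fun u => ?_) h1, h2, fun u => (h3 u).1, fun u A hA => ?_⟩
    · cases hX : t.label u with
      | terminal a => exact ⟨0, fun i hi => absurd hi ((h3 u).1 a hX i)⟩
      | nonterminal A =>
        obtain ⟨r, -, hr⟩ := (h3 u).2 A hX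
        exact ⟨_, fun i => (hr.1 i).1⟩
    · obtain ⟨r, h⟩ := (h3 u).2 A hA
      exact ⟨r.1, r.2, h⟩

theorem finite_symbol (T N : Type*) [Finite T] [Finite N] : Finite (Symbol T N) := by
  refine Finite.of_surjective (fun x : T ⊕ N => x.elim Symbol.terminal Symbol.nonterminal) ?_
  rintro (a | A)
  · exact ⟨.inl a, rfl⟩
  · exact ⟨.inr A, rfl⟩

open Expressible in
theorem expressible_isDerivationTree [Finite K] [Finite P] {T N : Type} [Finite T] [Finite N]
    (A : N) (R : Finset (ContextFreeRule T N)) (π : Symbol T N → Set P × Set K) :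
    Expressible fun (t : Tree K P) _ _ =>
      t.toLabeled ∈ LabeledTree.map π '' derivationTrees A R := by
  have := finite_symbol T N
  obtain ⟨m, ⟨e⟩⟩ := Finite.exists_equiv_fin (Symbol T N)
  have h1 := ((isRoot (K := K) (P := P) 0).imp (mem (e (.nonterminal A)) 0)).all 0
  have h2 := fun w : List (Symbol T N) => childList (K := K) (P := P) (fun b => e b) w
  have h3 := ((forall_finite fun a : T => (mem (e (.terminal a)) 0).imp (h2 [])).and
    (forall_finite fun A : N => (mem (e (.nonterminal A)) 0).imp
      (exists_finite fun r : R => (const (r.1.input = A)).and (h2 r.1.output)))).all 0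
  have h4 := (forall_finite fun b => (mem (e b) 0).imp (label (π b))).all 0
  -- `h1` fixes the start symbol at the root, `h3` checks terminals and productions, and `h4` checks
  -- that the guessed symbols project to the given labels.
  refine (exists_labelling e ((childInduction.and (h1.and h3)).and h4)
    (q := fun t l => (⟨t.dom, l⟩ : LabeledTree (Symbol T N)) ∈ derivationTrees A R ∧
      ∀ u, π (l u) = t.toLabeled.label u) ?_).congr fun t _ _ => ?_
  · intro t s S l hl
    simp only [Function.update_self, hl, exists_eq_right', forall_eq, forall_eq']
    refine and_congr ?_ Iff.rfl
    exact (isDerivationTree_iff (⟨N, A, R⟩ : ContextFreeGrammar T) ⟨t.dom, l⟩).symm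
  · constructor
    · rintro ⟨l, hl, h⟩
      refine ⟨_, hl, ?_⟩
      simp only [LabeledTree.map, h]
      rfl
    · rintro ⟨d, hd, h⟩
      obtain ⟨dom, I, R'⟩ := t
      obtain ⟨dom', l⟩ := d
      simp only [LabeledTree.map, Tree.toLabeled, LabeledTree.mk.injEq] at h
      obtain ⟨rfl, h⟩ := h
      exact ⟨l, hd, congrFun (eq_of_heq h)⟩

/-- A finite disjunction over the grammars suffices; injectivity of `Tree.toLabeled` carries the
equality of labelled trees back to `S`. -/
theorem IsProjectionOfLocal.definable [Finite K] [Finite P] {S : Set (Tree K P)}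
    (hS : IsProjectionOfLocal S) : Definable S := by
  obtain ⟨T, N, _, _, 𝒢, π, hfin, h⟩ := hS
  have := hfin.to_subtype
  refine definable_of_expressible ((Expressible.exists_finite fun g : 𝒢 =>
    expressible_isDerivationTree g.1.1 g.1.2 π).congr fun t _ _ => ?_)
  rw [← Tree.toLabeled_injective.mem_set_image (s := S), h, Set.image_iUnion₂]
  simp

theorem IsProjectionOfCFG.isProjectionOfLocal {S : Set (Tree K P)} (hS : IsProjectionOfCFG S) :
    IsProjectionOfLocal S := by
  obtain ⟨T, N, hT, hN, A, R, π, h⟩ := hS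
  exact ⟨T, N, hT, hN, {(A, R)}, π, Set.finite_singleton _, by simpa using h⟩

theorem IsProjectionOfCFG.sameRootLabel {S : Set (Tree K P)} (hS : IsProjectionOfCFG S) :
    SameRootLabel S := by
  obtain ⟨T, N, -, -, A, R, π, h⟩ := hS
  have key : ∀ t ∈ S, t.toLabeled.label t.toLabeled.dom.root = π (.nonterminal A) := by
    intro t ht
    obtain ⟨d, hd, hdt⟩ := h.subset (Set.mem_image_of_mem _ ht)
    rw [← hdt]
    exact congrArg π hd.2.1
  exact fun t ht t' ht' => (key t ht).trans (key t' ht').symm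

end LKP

theorem mainTheorem1 {K P : Type*} [Finite K] [Finite P] (S : Set (LKP.Tree K P))
    (hfin : LKP.AllFinite S) (hbd : LKP.BoundedBranching S) :
    (LKP.Definable S ↔ LKP.IsProjectionOfLocal S) ∧
      (LKP.Definable S ∧ LKP.SameRootLabel S ↔ LKP.IsProjectionOfCFG S) :=
  ⟨⟨fun h => h.isProjectionOfLocal hfin hbd, fun h => h.definable⟩,
    ⟨fun h => h.1.isProjectionOfCFG hfin hbd h.2,
      fun h => ⟨h.isProjectionOfLocal.definable, h.sameRootLabel⟩⟩⟩
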